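/- Let $F=\mathbb{F}_q$ be a finite field with $q$ elements, of characteristic $p$, let $n\ge 0$, and let $V$ be the $F$-vector space with basis $x_1,\dots,x_n$, so that $\mathbf{S}(V)=F[x_1,\dots,x_n]$. Let $\widehat{\mathbf{S}}(V)=\bigcup_{r\ge 0}F[x_1^{q^{-r}},\dots,x_n^{q^{-r}}]$ be the perfection of $\mathbf{S}(V)$, and let $\varphi$ be its automorphism $a\mapsto a^q$. For $\alpha\in\mathbb{N}^n$ put $A_\alpha=\det\bigl(x_i^{q^{\alpha_j}}\bigr)_{1\le i,j\le n}$, and let $\delta=(n-1,n-2,\dots,0)$. For a partition $\lambda$ of length $\ell(\lambda)\le n$ put $S_\lambda(V)=A_{\lambda+\delta}/A_\delta\in\mathbf{S}(V)$ (the division is exact), and put $S_\lambda(V)=0$ if $\ell(\lambda)>n$. Let $H_r(V)=S_{(r)}(V)$ for $r\ge 0$ and $H_r(V)=0$ for $r<0$. Let $E_r(V)=S_{(1^r)}(V)$ for $0\le r\le n$ and $E_r(V)=0$ for all other integers $r$. Write $\lambda'$ for the conjugate of a partition $\lambda$. For arbitrary partitions $\lambda,\mu$ the skew Schur function is defined by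 $$S_{\lambda/\mu}(V)=\det\bigl(\varphi^{\mu_j-j+1}H_{\lambda_i-\mu_j-i+j}(V)\bigr)_{1\le i,j\le m},\qquad m=\max(\ell(\lambda),\ell(\mu)).$$ Then for all partitions $\lambda$ and $\mu$: 1. the determinant defining $S_{\lambda/\mu}(V)$ has the same value for every $m$ with $m\ge\ell(\lambda)$ and $m\ge\ell(\mu)$; 2. for every $m$ with $m\ge\ell(\lambda')$ and $m\ge\ell(\mu')$, $$S_{\lambda/\mu}(V)=\det\bigl(\varphi^{-\mu'_j+j-1}E_{\lambda'_i-\mu'_j-i+j}(V)\bigr)_{1\le i,j\le m}\quad\text{in }\widehat{\mathbf{S}}(V);$$ 3. if $\ell(\lambda)\le n$, then for every $m\ge\ell(\lambda')$, $$S_\lambda(V)=\det\bigl(\varphi^{j-1}E_{\lambda'_i-i+j}(V)\bigr)_{1\le i,j\le m}\quad\text{in }\widehat{\mathbf{S}}(V).$$ -/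

import Mathlib

namespace FrobeniusSchur

/-- The partition `(r)`: a Young diagram with one row of `r` cells (empty if `r = 0`). -/
def rowPartition (r : ℕ) : YoungDiagram := YoungDiagram.ofRowLens [r] (List.pairwise_singleton _ r).sortedGE

/-- The partition `(1^r)`: a Young diagram with one column of `r` cells. -/
def colPartition (r : ℕ) : YoungDiagram := (rowPartition r).transpose

section Symmetric

variable (F : Type*) [Field F] [Fintype F] (n : ℕ)

/-- The symmetric algebra `S(V) = F[x_1, …, x_n]` of the `F`-vector space `V` with
basis `x_1, …, x_n`. -/
abbrev Sym : Type _ := MvPolynomial (Fin n) F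

/-- `A_α = det (x_i ^ (q ^ α_j))_{1 ≤ i, j ≤ n}`, where `q` is the number of elements of `F`. -/
noncomputable def altDet (α : Fin n → ℕ) : Sym F n :=
  Matrix.det (Matrix.of fun i j : Fin n =>
    (MvPolynomial.X i : Sym F n) ^ (Fintype.card F ^ α j))

/-- The staircase `δ = (n-1, n-2, …, 1, 0)`. -/
def stair (j : Fin n) : ℕ := n - 1 - (j : ℕ)

/-- `λ + δ`, truncated to its first `n` entries. -/
def addStair (l : YoungDiagram) (j : Fin n) : ℕ := l.rowLen j + stair n j

open Classical in
/-- `S_λ(V) = A_{λ+δ} / A_δ` for a partition `λ` of length at most `n`, and `S_λ(V) = 0` for a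
longer partition. The exact quotient of polynomials is meant: `A_δ` is nonzero and divides every
`A_α`, so the divisibility in the condition only serves to name the quotient. -/
noncomputable def schur (l : YoungDiagram) : Sym F n :=
  if h : l.colLen 0 ≤ n ∧ altDet F n (stair n) ∣ altDet F n (addStair n l) then
    h.2.choose
  else 0

/-- `H_r(V) = S_{(r)}(V)` for `r ≥ 0`, and `H_r(V) = 0` for `r < 0`. -/
noncomputable def completeH (r : ℤ) : Sym F n :=
  if 0 ≤ r then schur F n (rowPartition r.toNat) else 0

/-- `E_r(V) = S_{(1^r)}(V)` for `0 ≤ r ≤ n`, and `E_r(V) = 0` for all other integers `r`. -/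
noncomputable def elemE (r : ℤ) : Sym F n :=
  if 0 ≤ r ∧ r ≤ n then schur F n (colPartition r.toNat) else 0

end Symmetric

section Perfection

variable (p : ℕ) [Fact p.Prime] (F : Type*) [Field F] [Fintype F] [CharP F p] (n : ℕ)

/-- The perfection `Ŝ(V) = ⋃_r F[x_1^{q^{-r}}, …, x_n^{q^{-r}}]` of `S(V)`. -/
abbrev PerfSym : Type _ := PerfectClosure (Sym F n) p

/-- The automorphism `φ : a ↦ a ^ q` of `Ŝ(V)`, `q = |F|`; see `frob_apply`. -/
noncomputable def frob : RingAut (PerfSym p F n) :=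
  iterateFrobeniusEquiv (PerfSym p F n) p (Nat.log p (Fintype.card F))

theorem frob_apply (a : PerfSym p F n) : frob p F n a = a ^ Fintype.card F := by
  obtain ⟨k, hp, hk⟩ := FiniteField.card F p
  have h : p ^ Nat.log p (Fintype.card F) = Fintype.card F := by
    rw [hk, Nat.log_pow hp.one_lt]
  rw [frob, iterateFrobeniusEquiv_def, h]

/-- The `m × m` matrix `(φ^{μ_j-j+1} H_{λ_i-μ_j-i+j}(V))`. Rows and columns are numbered from `0`
here, so that `μ_j - j + 1` reads `μ.rowLen j - j`. -/
noncomputable def matH (m : ℕ) (l mu : YoungDiagram) :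
    Matrix (Fin m) (Fin m) (PerfSym p F n) :=
  Matrix.of fun i j =>
    (frob p F n ^ ((mu.rowLen j : ℤ) - (j : ℕ)))
      (PerfectClosure.of (Sym F n) p
        (completeH F n ((l.rowLen i : ℤ) - mu.rowLen j - (i : ℕ) + (j : ℕ))))

/-- The `m × m` matrix `(φ^{-μ'_j+j-1} E_{λ'_i-μ'_j-i+j}(V))`. Rows and columns are numbered from
`0` here, so that `-μ'_j + j - 1` reads `-μ.colLen j + j`. -/
noncomputable def matE (m : ℕ) (l mu : YoungDiagram) :
    Matrix (Fin m) (Fin m) (PerfSym p F n) :=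
  Matrix.of fun i j =>
    (frob p F n ^ (-(mu.colLen j : ℤ) + (j : ℕ)))
      (PerfectClosure.of (Sym F n) p
        (elemE F n ((l.colLen i : ℤ) - mu.colLen j - (i : ℕ) + (j : ℕ))))

/-- The skew Schur function `S_{λ/μ}(V) = det (φ^{μ_j-j+1} H_{λ_i-μ_j-i+j}(V))`, with the smallest
matrix size `max (ℓ(λ), ℓ(μ))`. -/
noncomputable def skewSchur (l mu : YoungDiagram) : PerfSym p F n :=
  (matH p F n (max (l.colLen 0) (mu.colLen 0)) l mu).det

end Perfection

end FrobeniusSchur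

namespace FrobeniusSchur

/-! The heart is a pair of mutually inverse unitriangular matrices, `twistH` and `twistE`. Their
product is the identity by the twisted relation `∑ (-1)^r φ^s(E_r) H_{s+1-r} = 0`. A partition in an
`m₁ × m₂` box splits `0, …, m₁ + m₂ - 1` into two complementary sets, one read from its rows and one
from its columns. The minor of `twistH` cut out by the row sets of `λ` and `μ` is the
`H`-determinant. By Jacobi's identity it equals, up to sign, the complementary minor of `twistE`,
which is the `E`-determinant; the signs cancel (`det_skewH_eq_det_skewE`).

The twisted relation comes from Moore determinants. Expanding a determinant with a repeated row
shows that the `x_i` are roots of the `q`-polynomial with coefficients `(-1)^r E_r`. Raising this to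
the power `q^s` and applying Cramer's rule brings in the `H_r`.

For `S_λ` itself, the same `q`-polynomial lets one factor the matrix of all Frobenius powers of the
`x_i` through `twistH`. Every `A_{λ+δ}` is then an `H`-determinant times a factor independent of
`λ`, and the empty partition identifies that factor as `A_δ`. -/

open Matrix

/-! ### Complementary minors -/

section ComplementaryMinor

/-- Jacobi's identity for complementary minors of mutually inverse block matrices. -/
theorem det_toBlocks₁₁_of_mul_eq_one {m n R : Type*} [Fintype m] [Fintype n] [DecidableEq m]
    [DecidableEq n] [CommRing R] {A B : Matrix (m ⊕ n) (m ⊕ n) R} (h : A * B = 1) :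
    A.toBlocks₁₁.det = A.det * B.toBlocks₂₂.det := by
  have hA := fromBlocks_toBlocks A
  have hB := fromBlocks_toBlocks B
  have hAB := h
  rw [← hA, ← hB, fromBlocks_multiply, ← fromBlocks_one, fromBlocks_inj] at hAB
  obtain ⟨-, h12, -, h22⟩ := hAB
  -- Replacing the first block column of `B` by that of the identity makes both sides block
  -- triangular.
  have key : A * fromBlocks 1 B.toBlocks₁₂ 0 B.toBlocks₂₂ =
      fromBlocks A.toBlocks₁₁ 0 A.toBlocks₂₁ 1 := by
    conv_lhs => rw [← hA]
    rw [fromBlocks_multiply, h12, h22]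
    simp
  have := congrArg det key
  rw [det_mul, det_fromBlocks_zero₂₁, det_fromBlocks_zero₁₂, det_one, det_one, one_mul,
    mul_one] at this
  exact this.symm

end ComplementaryMinor

/-! ### Complementary index sets of a partition and their sign -/

section BlockIndex

/-- Underlying function of `blockIndex`. -/
def blockFun (l : YoungDiagram) {m₁ m₂ : ℕ} (h₁ : l.colLen 0 ≤ m₁) :
    Fin m₁ ⊕ Fin m₂ → Fin (m₁ + m₂) :=
  Sum.elim (fun i => ⟨m₂ - l.rowLen i + i, by omega⟩)
    (fun j => ⟨m₂ + l.colLen j - 1 - j, by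
      have := l.colLen_anti 0 j (Nat.zero_le _)
      omega⟩)

theorem lt_rowLen_iff_lt_colLen (l : YoungDiagram) (i j : ℕ) :
    j < l.rowLen i ↔ i < l.colLen j := by
  rw [← YoungDiagram.mem_iff_lt_rowLen, ← YoungDiagram.mem_iff_lt_colLen]

variable (l : YoungDiagram) {m₁ m₂ : ℕ} (h₁ : l.colLen 0 ≤ m₁) (h₂ : l.rowLen 0 ≤ m₂)

-- The first family increases strictly and the second decreases strictly. Across the families,
-- whether the cell `(i, j)` lies in `l` or not decides which value is strictly larger.
include h₂ in
theorem blockFun_injective : Function.Injective (blockFun l (m₂ := m₂) h₁) := by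
  rintro (i | i) (j | j) h
  · simp only [blockFun, Sum.elim_inl, Fin.mk.injEq] at h
    have := l.rowLen_anti 0 i (Nat.zero_le _)
    have := l.rowLen_anti 0 j (Nat.zero_le _)
    rcases le_total (i : ℕ) j with hij | hij
    · have := l.rowLen_anti _ _ hij
      congr 1; ext; omega
    · have := l.rowLen_anti _ _ hij
      congr 1; ext; omega
  · simp only [blockFun, Sum.elim_inl, Sum.elim_inr, Fin.mk.injEq] at h
    have := l.rowLen_anti 0 i (Nat.zero_le _)
    have := lt_rowLen_iff_lt_colLen l i j
    omega
  · simp only [blockFun, Sum.elim_inl, Sum.elim_inr, Fin.mk.injEq] at h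
    have := l.rowLen_anti 0 j (Nat.zero_le _)
    have := lt_rowLen_iff_lt_colLen l j i
    omega
  · simp only [blockFun, Sum.elim_inr, Fin.mk.injEq] at h
    rcases le_total (i : ℕ) j with hij | hij
    · have := l.colLen_anti _ _ hij
      congr 1; ext; omega
    · have := l.colLen_anti _ _ hij
      congr 1; ext; omega

/-- For a partition `λ` in an `m₁ × m₂` box, the numbers `m₂ - λ_i + i` and
`m₂ - 1 + λ'_j - j` together exhaust `0, …, m₁ + m₂ - 1`. -/
noncomputable def blockIndex : Fin m₁ ⊕ Fin m₂ ≃ Fin (m₁ + m₂) :=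
  Equiv.ofBijective (blockFun l h₁)
    ((Fintype.bijective_iff_injective_and_card _).2 ⟨blockFun_injective l h₁ h₂, by simp⟩)

theorem blockIndex_inl (i : Fin m₁) :
    (blockIndex l h₁ h₂ (Sum.inl i) : ℕ) = m₂ - l.rowLen i + i := rfl

theorem blockIndex_inr (j : Fin m₂) :
    (blockIndex l h₁ h₂ (Sum.inr j) : ℕ) = m₂ + l.colLen j - 1 - j := rfl

/-- The permutation of `0, …, m₁ + m₂ - 1` given by `blockIndex`. -/
noncomputable def blockPerm : Equiv.Perm (Fin (m₁ + m₂)) :=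
  finSumFinEquiv.symm.trans (blockIndex l h₁ h₂)

theorem prod_range_neg_one_ite (c m : ℕ) (h : c ≤ m) :
    ∏ i : Fin m, (if (i : ℕ) < c then 1 else (-1 : ℤˣ)) = (-1) ^ m * (-1) ^ c := by
  rw [Fin.prod_univ_eq_prod_range (fun i => if i < c then 1 else (-1 : ℤˣ)) m]
  obtain ⟨d, rfl⟩ := Nat.exists_eq_add_of_le h
  rw [Finset.prod_range_add, Finset.prod_eq_one (by
    intro i hi; rw [if_pos (Finset.mem_range.1 hi)]), one_mul,
    Finset.prod_congr rfl (g := fun _ => (-1 : ℤˣ)) (by intro i _; rw [if_neg (by omega)])]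
  rw [Finset.prod_const, Finset.card_range, pow_add, mul_right_comm, ← mul_pow]
  simp

/-- Count inversions: none inside the first block, all pairs inside the second, and between the
blocks exactly the cells of the box outside `l`. -/
theorem sign_blockPerm : Equiv.Perm.sign (blockPerm l h₁ h₂) =
    (∏ j : Fin m₂, ∏ _i ∈ Finset.Iio j, (-1 : ℤˣ)) *
      ((-1) ^ (m₁ * m₂) * ∏ j : Fin m₂, (-1) ^ l.colLen j) := by
  have hinl (i : Fin m₁) :
      (blockPerm l h₁ h₂ (Fin.castAdd m₂ i) : ℕ) = m₂ - l.rowLen i + i := by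
    simp [blockPerm, blockIndex_inl]
  have hinr (j : Fin m₂) :
      (blockPerm l h₁ h₂ (Fin.natAdd m₁ j) : ℕ) = m₂ + l.colLen j - 1 - j := by
    simp [blockPerm, blockIndex_inr]
  have conv (j : Fin (m₁ + m₂)) (f : Fin (m₁ + m₂) → ℤˣ) :
      ∏ i ∈ Finset.Iio j, f i = ∏ i, if i < j then f i else 1 := by
    rw [← Finset.prod_filter]; congr 1; ext; simp
  rw [Equiv.Perm.sign_eq_prod_prod_Iio]
  simp_rw [conv]
  rw [Fin.prod_univ_add]
  simp_rw [Fin.prod_univ_add]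
  simp only [Fin.lt_def, hinl, hinr, Fin.val_castAdd, Fin.val_natAdd]
  rw [Finset.prod_eq_one, one_mul, Finset.prod_mul_distrib, mul_comm]
  · congr 1
    · refine Finset.prod_congr rfl fun j _ => ?_
      rw [show Finset.Iio j = Finset.univ.filter (· < j) by ext; simp, Finset.prod_filter]
      refine Finset.prod_congr rfl fun i _ => ?_
      simp only [add_lt_add_iff_left, Fin.lt_def]
      split_ifs with h h'
      · have := l.colLen_anti _ _ h.le
        omega
      · rfl
      · rfl
    · rw [pow_mul, ← Fin.prod_const, ← Finset.prod_mul_distrib]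
      refine Finset.prod_congr rfl fun j _ => ?_
      rw [← prod_range_neg_one_ite _ _ ((l.colLen_anti 0 j (Nat.zero_le _)).trans h₁)]
      refine Finset.prod_congr rfl fun i _ => ?_
      have := l.rowLen_anti 0 i (Nat.zero_le _)
      have := lt_rowLen_iff_lt_colLen l i j
      rw [if_pos (by omega)]
      congr 1
      exact propext ⟨fun h => by omega, fun h => by omega⟩
  · intro j _
    rw [Finset.prod_eq_one, Finset.prod_eq_one, one_mul]
    · intro i _
      rw [if_neg (by omega)]
    · intro i _
      split_ifs with h h'
      · rfl
      · have := l.rowLen_anti _ _ h.le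
        have := l.rowLen_anti 0 i (Nat.zero_le _)
        omega
      · rfl

end BlockIndex

/-! ### The two inverse triangular matrices -/

section Toeplitz

variable {K : Type*} [CommRing K] (φ : RingAut K) (E H : ℤ → K) (m N : ℕ)

/-- The triangular matrix `(φ^{m-l} H_{l-k})`. -/
def twistH : Matrix (Fin N) (Fin N) K :=
  of fun k l => (φ ^ ((m : ℤ) - (l : ℕ))) (H ((l : ℕ) - (k : ℕ)))

/-- The triangular matrix `((-1)^{k+l} φ^{m-k-1} E_{l-k})`. -/
def twistE : Matrix (Fin N) (Fin N) K :=
  of fun k l => (-1) ^ ((k : ℕ) + (l : ℕ)) * (φ ^ ((m : ℤ) - (k : ℕ) - 1)) (E ((l : ℕ) - (k : ℕ)))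

variable {E H}

theorem zpow_apply_zpow_apply (a b : ℤ) (x : K) : (φ ^ a) ((φ ^ b) x) = (φ ^ (a + b)) x := by
  rw [_root_.zpow_add]; rfl

theorem det_twistH (hH : ∀ r < 0, H r = 0) (hH0 : H 0 = 1) : (twistH φ H m N).det = 1 := by
  rw [det_of_isUpperTriangular]
  · simp [twistH, hH0]
  · intro i j hij
    have : (j : ℕ) < i := hij
    simp [twistH, hH ((j : ℕ) - (i : ℕ)) (by omega)]

theorem sum_fin_eq_sum_range_shift {N k j : ℕ} (hk : k ≤ j) (hj : j < N) (f : ℕ → K)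
    (h1 : ∀ l < k, f l = 0) (h2 : ∀ l, j < l → f l = 0) :
    ∑ l : Fin N, f l = ∑ r ∈ Finset.range (j - k + 1), f (k + r) := by
  rw [Fin.sum_univ_eq_sum_range f N]
  obtain ⟨d, rfl⟩ := Nat.exists_eq_add_of_le (show k + (j - k + 1) ≤ N by omega)
  rw [Finset.sum_range_add, Finset.sum_range_add, Finset.sum_eq_zero (s := Finset.range k),
    Finset.sum_eq_zero (s := Finset.range d), zero_add, add_zero]
  · intro i _; exact h2 _ (by omega)
  · intro i hi; exact h1 _ (Finset.mem_range.1 hi)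

theorem twistE_mul_twistH (hE : ∀ r < 0, E r = 0) (hE0 : E 0 = 1)
    (hH : ∀ r < 0, H r = 0) (hH0 : H 0 = 1)
    (hEH : ∀ s : ℕ, ∑ r ∈ Finset.range (s + 2),
      (-1) ^ r * (φ ^ (s : ℤ)) (E r) * H ((s : ℤ) + 1 - r) = 0) :
    twistE φ E m N * twistH φ H m N = 1 := by
  ext k j
  rw [mul_apply, one_apply]
  simp only [twistE, twistH, of_apply]
  rcases lt_or_ge (j : ℕ) (k : ℕ) with hjk | hkj
  · rw [if_neg (by rintro rfl; omega)]
    refine Finset.sum_eq_zero fun l _ => ?_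
    rcases lt_or_ge (l : ℕ) (k : ℕ) with h | h
    · rw [hE _ (by omega)]; simp
    · rw [hH _ (by omega)]; simp
  rw [sum_fin_eq_sum_range_shift hkj j.2 (fun l => (-1) ^ ((k : ℕ) + l) *
    (φ ^ ((m : ℤ) - (k : ℕ) - 1)) (E (l - (k : ℕ))) * (φ ^ ((m : ℤ) - (j : ℕ))) (H ((j : ℕ) - l)))
    (fun l h => by rw [hE _ (by omega)]; simp) (fun l h => by rw [hH _ (by omega)]; simp)]
  rcases hkj.eq_or_lt with h | h
  · rw [if_pos (Fin.ext h)]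
    simp [h, hE0, hH0, ← two_mul]
  · rw [if_neg (by rintro rfl; omega)]
    obtain ⟨s, hs⟩ := Nat.exists_eq_add_of_lt h
    -- Here `j - k = s + 1`, so this twist turns `φ ^ s` into the `φ ^ (m - k - 1)` of row `k`.
    have := congrArg (φ ^ ((m : ℤ) - (j : ℕ))) (hEH s)
    rw [map_zero, map_sum] at this
    rw [← this]
    refine Finset.sum_congr (by congr 1; omega) fun r _ => ?_
    rw [map_mul, map_mul, map_pow, map_neg, map_one, zpow_apply_zpow_apply, ← add_assoc, pow_add,
      ← two_mul, pow_mul]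
    have e1 : (m : ℤ) - (k : ℕ) - 1 = m - (j : ℕ) + s := by omega
    have e2 : (((k : ℕ) + r : ℕ) : ℤ) - (k : ℕ) = r := by omega
    have e3 : ((j : ℕ) : ℤ) - (((k : ℕ) + r : ℕ) : ℤ) = s + 1 - r := by omega
    rw [e1, e2, e3]
    simp

end Toeplitz

/-! ### Stability in the matrix size and the dual determinant -/

section JacobiTrudi

variable {K : Type*} [CommRing K] (φ : RingAut K) (E H : ℤ → K)

/-- The matrix `(φ^{μ_j-j} H_{λ_i-μ_j-i+j})`. -/
def skewH (m : ℕ) (l mu : YoungDiagram) : Matrix (Fin m) (Fin m) K :=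
  of fun i j => (φ ^ ((mu.rowLen j : ℤ) - (j : ℕ)))
    (H ((l.rowLen i : ℤ) - mu.rowLen j - (i : ℕ) + (j : ℕ)))

/-- The matrix `(φ^{-μ'_j+j} E_{λ'_i-μ'_j-i+j})`. -/
def skewE (m : ℕ) (l mu : YoungDiagram) : Matrix (Fin m) (Fin m) K :=
  of fun i j => (φ ^ (-(mu.colLen j : ℤ) + (j : ℕ)))
    (E ((l.colLen i : ℤ) - mu.colLen j - (i : ℕ) + (j : ℕ)))

variable {E H}

theorem rowLen_eq_zero {l : YoungDiagram} {i : ℕ} (h : l.colLen 0 ≤ i) : l.rowLen i = 0 := by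
  have := lt_rowLen_iff_lt_colLen l i 0
  omega

/-- The last row of the larger matrix is `(0, …, 0, 1)`, since its earlier entries have negative
index. -/
theorem det_skewH_succ (hH : ∀ r < 0, H r = 0) (hH0 : H 0 = 1) (l mu : YoungDiagram) (m : ℕ)
    (hl : l.colLen 0 ≤ m) (hmu : mu.colLen 0 ≤ m) :
    (skewH φ H (m + 1) l mu).det = (skewH φ H m l mu).det := by
  rw [det_succ_row _ (Fin.last m), Finset.sum_eq_single (Fin.last m)]
  · rw [show skewH φ H (m + 1) l mu (Fin.last m) (Fin.last m) = 1 by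
      simp [skewH, rowLen_eq_zero hl, rowLen_eq_zero hmu, hH0]]
    rw [← two_mul, pow_mul]
    simp only [even_two, Even.neg_pow, one_pow, mul_one, one_mul]
    congr 1
    ext i j
    simp [skewH]
  · intro j _ hj
    have : (j : ℕ) < m := Fin.lt_last_iff_ne_last.2 hj
    rw [show skewH φ H (m + 1) l mu (Fin.last m) j = 0 by
      simp only [skewH, of_apply, Fin.val_last, rowLen_eq_zero hl]
      rw [hH _ (by push_cast; omega), map_zero]]
    simp
  · simp

theorem det_skewH_eq (hH : ∀ r < 0, H r = 0) (hH0 : H 0 = 1) (l mu : YoungDiagram) (m m' : ℕ)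
    (hl : l.colLen 0 ≤ m) (hmu : mu.colLen 0 ≤ m) (hm : m ≤ m') :
    (skewH φ H m' l mu).det = (skewH φ H m l mu).det := by
  induction m', hm using Nat.le_induction with
  | base => rfl
  | succ k hk ih => rw [det_skewH_succ φ hH hH0 l mu k (hl.trans hk) (hmu.trans hk), ih]

theorem twistH_submatrix_blockIndex (l mu : YoungDiagram) {m₁ m₂ : ℕ}
    (hl₁ : l.colLen 0 ≤ m₁) (hl₂ : l.rowLen 0 ≤ m₂)
    (hmu₁ : mu.colLen 0 ≤ m₁) (hmu₂ : mu.rowLen 0 ≤ m₂) (i j : Fin m₁) :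
    twistH φ H m₂ (m₁ + m₂) (blockIndex l hl₁ hl₂ (Sum.inl i))
      (blockIndex mu hmu₁ hmu₂ (Sum.inl j)) = skewH φ H m₁ l mu i j := by
  simp only [twistH, skewH, of_apply, blockIndex_inl]
  have := l.rowLen_anti 0 i (Nat.zero_le _)
  have := mu.rowLen_anti 0 j (Nat.zero_le _)
  rw [show (m₂ : ℤ) - ((m₂ - mu.rowLen j + j : ℕ) : ℤ) = mu.rowLen j - (j : ℕ) by omega]
  congr 2
  omega

theorem twistE_submatrix_blockIndex (l mu : YoungDiagram) {m₁ m₂ : ℕ}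
    (hl₁ : l.colLen 0 ≤ m₁) (hl₂ : l.rowLen 0 ≤ m₂)
    (hmu₁ : mu.colLen 0 ≤ m₁) (hmu₂ : mu.rowLen 0 ≤ m₂) (i j : Fin m₂) :
    twistE φ E m₂ (m₁ + m₂) (blockIndex mu hmu₁ hmu₂ (Sum.inr j))
      (blockIndex l hl₁ hl₂ (Sum.inr i)) =
      (-1) ^ (m₂ + mu.colLen j - 1 - j) * ((-1) ^ (m₂ + l.colLen i - 1 - i) *
        skewE φ E m₂ l mu i j) := by
  simp only [twistE, skewE, of_apply, blockIndex_inr]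
  rw [← mul_assoc, ← pow_add]
  rw [show (m₂ : ℤ) - ((m₂ + mu.colLen j - 1 - j : ℕ) : ℤ) - 1 = -mu.colLen j + (j : ℕ) by omega]
  congr 3
  omega

/-- The parts of the exponents not involving the column lengths agree in both products, so they
contribute an even power. -/
theorem prod_neg_one_pow_colLen (l mu : YoungDiagram) (m : ℕ) :
    (∏ j : Fin m, (-1 : ℤˣ) ^ (m + mu.colLen j - 1 - j)) *
      (∏ i : Fin m, (-1) ^ (m + l.colLen i - 1 - i)) =
    (∏ j : Fin m, (-1) ^ mu.colLen j) * ∏ i : Fin m, (-1) ^ l.colLen i := by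
  rw [← Finset.prod_mul_distrib, ← Finset.prod_mul_distrib]
  refine Finset.prod_congr rfl fun j _ => ?_
  rw [← pow_add, ← pow_add, show m + mu.colLen j - 1 - j + (m + l.colLen j - 1 - j) =
    2 * (m - 1 - j) + (mu.colLen j + l.colLen j) by omega, pow_add, pow_mul]
  simp

/-- The dual Jacobi–Trudi formula: a minor of `twistH` is a complementary minor of its inverse. -/
theorem det_skewH_eq_det_skewE (hE : ∀ r < 0, E r = 0) (hE0 : E 0 = 1)
    (hH : ∀ r < 0, H r = 0) (hH0 : H 0 = 1)
    (hEH : ∀ s : ℕ, ∑ r ∈ Finset.range (s + 2),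
      (-1) ^ r * (φ ^ (s : ℤ)) (E r) * H ((s : ℤ) + 1 - r) = 0)
    (l mu : YoungDiagram) {m₁ m₂ : ℕ}
    (hl₁ : l.colLen 0 ≤ m₁) (hl₂ : l.rowLen 0 ≤ m₂)
    (hmu₁ : mu.colLen 0 ≤ m₁) (hmu₂ : mu.rowLen 0 ≤ m₂) :
    (skewH φ H m₁ l mu).det = (skewE φ E m₂ l mu).det := by
  set A := twistH φ H m₂ (m₁ + m₂)
  set B := twistE φ E m₂ (m₁ + m₂)
  set e := blockIndex l hl₁ hl₂
  set f := blockIndex mu hmu₁ hmu₂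
  have hAB : A * B = 1 := mul_eq_one_comm.1 (twistE_mul_twistH φ m₂ _ hE hE0 hH hH0 hEH)
  have hblock : A.submatrix e f * B.submatrix f e = 1 := by
    rw [submatrix_mul_equiv, hAB, submatrix_one_equiv]
  -- The full determinant survives only as the signs of the two reindexings, because `A` is
  -- unitriangular.
  have hdet : (A.submatrix e f).det =
      ((Equiv.Perm.sign (blockPerm l hl₁ hl₂) * Equiv.Perm.sign (blockPerm mu hmu₁ hmu₂) : ℤˣ) :
        ℤ) := by
    rw [← det_submatrix_equiv_self finSumFinEquiv.symm, submatrix_submatrix,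
      show A.submatrix (e ∘ finSumFinEquiv.symm) (f ∘ finSumFinEquiv.symm) =
        (A.submatrix id (blockPerm mu hmu₁ hmu₂)).submatrix (blockPerm l hl₁ hl₂) id from rfl,
      det_permute, det_permute', det_twistH φ _ _ hH hH0]
    push_cast
    ring
  have h11 : (A.submatrix e f).toBlocks₁₁ = skewH φ H m₁ l mu := by
    ext i j
    exact twistH_submatrix_blockIndex φ l mu hl₁ hl₂ hmu₁ hmu₂ i j
  have h22 : (B.submatrix f e).toBlocks₂₂ = of fun j i : Fin m₂ =>
      (-1) ^ (m₂ + mu.colLen j - 1 - j) * (of fun j i : Fin m₂ =>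
        (-1) ^ (m₂ + l.colLen i - 1 - i) * (skewE φ E m₂ l mu)ᵀ j i) j i := by
    ext j i
    exact twistE_submatrix_blockIndex φ l mu hl₁ hl₂ hmu₁ hmu₂ i j
  have h := det_toBlocks₁₁_of_mul_eq_one hblock
  rw [h11, h22, det_mul_column, det_mul_row, det_transpose, hdet, ← mul_assoc, ← mul_assoc] at h
  rw [h]
  -- Each factor of the permutation signs occurs twice: in the other permutation, or in the
  -- alternating signs of `twistE`.
  have hs : Equiv.Perm.sign (blockPerm l hl₁ hl₂) * Equiv.Perm.sign (blockPerm mu hmu₁ hmu₂) *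
      ((∏ j : Fin m₂, (-1 : ℤˣ) ^ (m₂ + mu.colLen j - 1 - j)) *
      (∏ i : Fin m₂, (-1) ^ (m₂ + l.colLen i - 1 - i))) = 1 := by
    rw [prod_neg_one_pow_colLen, sign_blockPerm, sign_blockPerm]
    generalize (∏ j : Fin m₂, ∏ _i ∈ Finset.Iio j, (-1 : ℤˣ)) = a
    generalize (∏ j : Fin m₂, (-1 : ℤˣ) ^ mu.colLen j) = b
    generalize (∏ j : Fin m₂, (-1 : ℤˣ) ^ l.colLen j) = c
    generalize ((-1 : ℤˣ) ^ (m₁ * m₂)) = d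
    calc _ = (a * a) * (b * b) * (c * c) * (d * d) := by
          simp only [mul_comm, mul_left_comm]
      _ = 1 := by simp only [Int.units_mul_self, mul_one]
  have hs' := congrArg (fun u : ℤˣ => ((u : ℤ) : K)) hs
  push_cast at hs'
  rw [← mul_assoc] at hs'
  push_cast
  rw [hs', one_mul]

end JacobiTrudi

/-! ### Factoring alternants through `twistH` -/

section Bialternant

theorem bot_colLen_rowLen :
    (⊥ : YoungDiagram).colLen 0 = 0 ∧ (⊥ : YoungDiagram).rowLen 0 = 0 := by
  constructor <;> by_contra h
  · exact YoungDiagram.notMem_bot _ (YoungDiagram.mem_iff_lt_colLen.2 (Nat.pos_of_ne_zero h))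
  · exact YoungDiagram.notMem_bot _ (YoungDiagram.mem_iff_lt_rowLen.2 (Nat.pos_of_ne_zero h))

variable {K : Type*} [CommRing K] (φ : RingAut K) {E H : ℤ → K}

/-- Each of the first `m` rows pairs to a Frobenius twist of the `q`-polynomial relation `hx`; for
these rows all `n + 1` terms fit inside the matrix. -/
theorem twistE_mul_eq_zero {n : ℕ} (x : Fin n → K) (m : ℕ)
    (hE : ∀ r < 0, E r = 0) (hEn : ∀ r > (n : ℤ), E r = 0)
    (hx : ∀ i, ∑ r ∈ Finset.range (n + 1),
      (-1) ^ r * E r * (φ ^ ((n : ℤ) - r)) (x i) = 0)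
    (k : Fin (n + m)) (hk : (k : ℕ) < m) (i : Fin n) :
    (twistE φ E m (n + m) *
      of fun (k : Fin (n + m)) i => (φ ^ ((n + m : ℤ) - 1 - (k : ℕ))) (x i)) k i = 0 := by
  rw [mul_apply]
  simp only [twistE, of_apply]
  rw [sum_fin_eq_sum_range_shift (k := k) (j := k + n) (by omega) (by omega)
    (fun l => (-1) ^ ((k : ℕ) + l) * (φ ^ ((m : ℤ) - (k : ℕ) - 1)) (E (l - (k : ℕ))) *
      (φ ^ ((n + m : ℤ) - 1 - l)) (x i))
    (fun l h => by rw [hE _ (by omega)]; simp) (fun l h => by rw [hEn _ (by omega)]; simp)]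
  have := congrArg (φ ^ ((m : ℤ) - (k : ℕ) - 1)) (hx i)
  rw [map_zero, map_sum] at this
  rw [← this]
  refine Finset.sum_congr (by congr 1; omega) fun r _ => ?_
  rw [map_mul, map_mul, map_pow, map_neg, map_one, zpow_apply_zpow_apply, ← add_assoc, pow_add,
    ← two_mul, pow_mul]
  have e1 : (((k : ℕ) + r : ℕ) : ℤ) - (k : ℕ) = r := by omega
  have e2 : (n + m : ℤ) - 1 - (((k : ℕ) + r : ℕ) : ℤ) = m - (k : ℕ) - 1 + (n - r) := by
    push_cast; ring
  rw [e1, e2]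
  simp

theorem det_zpow_eq_mul {n : ℕ} (x : Fin n → K)
    (hE : ∀ r < 0, E r = 0) (hE0 : E 0 = 1) (hEn : ∀ r > (n : ℤ), E r = 0)
    (hH : ∀ r < 0, H r = 0) (hH0 : H 0 = 1)
    (hEH : ∀ s : ℕ, ∑ r ∈ Finset.range (s + 2),
      (-1) ^ r * (φ ^ (s : ℤ)) (E r) * H ((s : ℤ) + 1 - r) = 0)
    (hx : ∀ i, ∑ r ∈ Finset.range (n + 1),
      (-1) ^ r * E r * (φ ^ ((n : ℤ) - r)) (x i) = 0)
    (m : ℕ) : ∃ y : K, ∀ l : YoungDiagram, l.colLen 0 ≤ n → l.rowLen 0 ≤ m →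
      (of fun i k : Fin n => (φ ^ ((l.rowLen i : ℤ) + (n - 1 - (i : ℕ)))) (x k)).det =
        (skewH φ H n l ⊥).det * y := by
  set X : Matrix (Fin (n + m)) (Fin n) K :=
    of fun k i => (φ ^ ((n + m : ℤ) - 1 - (k : ℕ))) (x i) with hX
  set A := twistH φ H m (n + m)
  set B := twistE φ E m (n + m)
  have hAB : A * B = 1 := mul_eq_one_comm.1 (twistE_mul_twistH φ m _ hE hE0 hH hH0 hEH)
  have hAY : X = A * (B * X) := by rw [← Matrix.mul_assoc, hAB, Matrix.one_mul]
  have b₁ : (⊥ : YoungDiagram).colLen 0 ≤ n := by simp [bot_colLen_rowLen]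
  have b₂ : (⊥ : YoungDiagram).rowLen 0 ≤ m := by simp [bot_colLen_rowLen]
  -- The row set of the empty partition is the last `n` rows, the only ones where `B * X` can be
  -- nonzero. Hence `y` does not see `l`.
  refine ⟨(of fun j i => (B * X) (blockIndex ⊥ b₁ b₂ (Sum.inl j)) i).det, fun l h₁ h₂ => ?_⟩
  rw [← det_mul]
  congr 1
  ext i k
  have h : X (blockIndex l h₁ h₂ (Sum.inl i)) k =
      (A * (B * X)) (blockIndex l h₁ h₂ (Sum.inl i)) k := congrFun (congrFun hAY _) _
  rw [mul_apply, ← Equiv.sum_comp (blockIndex ⊥ b₁ b₂), Fintype.sum_sum_type,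
    Finset.sum_eq_zero (s := (Finset.univ : Finset (Fin m))), add_zero] at h
  · rw [mul_apply]
    simp only [of_apply]
    simp_rw [← twistH_submatrix_blockIndex φ l ⊥ h₁ h₂ b₁ b₂]
    rw [← h, hX, of_apply, blockIndex_inl]
    have := l.rowLen_anti 0 i (Nat.zero_le _)
    congr 2
    omega
  · intro j _
    rw [twistE_mul_eq_zero φ x m hE hEn hx, mul_zero]
    rw [blockIndex_inr]
    have := (⊥ : YoungDiagram).colLen_anti 0 j (Nat.zero_le _)
    have := bot_colLen_rowLen.1
    omega

end Bialternant

/-! ### Moore determinants and the relation between `E` and `H` -/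

section Moore

theorem exists_ringHom_eq_pow (p : ℕ) [Fact p.Prime] (F : Type*) [Field F] [Fintype F] [CharP F p]
    (R : Type*) [CommRing R] [CharP R p] (s : ℕ) :
    ∃ ψ : R →+* R, ∀ a, ψ a = a ^ Fintype.card F ^ s := by
  obtain ⟨k, -, hk⟩ := FiniteField.card F p
  refine ⟨iterateFrobenius R p (k * s), fun a => ?_⟩
  rw [iterateFrobenius_def, hk, pow_mul]

/-- Finitely many elements of a ring are common zeros of a monic `q`-polynomial. -/
theorem exists_monic_additive (p : ℕ) [Fact p.Prime] (F : Type*) [Field F] [Fintype F] [CharP F p]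
    (R : Type*) [CommRing R] [CharP R p] (x : ℕ → R) (m : ℕ) :
    ∃ c : ℕ → R, c m = 1 ∧ ∀ i < m,
      ∑ j ∈ Finset.range (m + 1), c j * x i ^ Fintype.card F ^ j = 0 := by
  induction m with
  | zero => exact ⟨fun _ => 1, rfl, fun i hi => absurd hi (Nat.not_lt_zero _)⟩
  | succ m ih =>
    obtain ⟨c, hc, h⟩ := ih
    obtain ⟨ψ, hψ⟩ := exists_ringHom_eq_pow p F R 1
    simp only [pow_one] at hψ
    set q := Fintype.card F
    have hq : q ≠ 0 := Fintype.card_ne_zero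
    set S : ℕ → R := fun i => ∑ j ∈ Finset.range (m + 1), c j * x i ^ q ^ j with hS
    -- If `L` kills the first `m` elements, then `L^q - L(x_m)^(q-1) L` also kills `x_m`; these are
    -- its coefficients.
    refine ⟨fun j => (if j = 0 then 0 else c (j - 1) ^ q) -
      S m ^ (q - 1) * (if j ≤ m then c j else 0), by simp [hc], fun i hi => ?_⟩
    have key : ∑ j ∈ Finset.range (m + 1 + 1), ((if j = 0 then 0 else c (j - 1) ^ q) -
        S m ^ (q - 1) * (if j ≤ m then c j else 0)) * x i ^ q ^ j =
        S i ^ q - S m ^ (q - 1) * S i := by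
      simp_rw [sub_mul]
      rw [Finset.sum_sub_distrib]
      congr 1
      · rw [Finset.sum_range_succ', ← hψ (S i), hS, map_sum]
        simp only [Nat.succ_ne_zero, if_false, if_true, zero_mul, add_zero, mul_pow,
          Nat.add_sub_cancel, hψ, ← pow_mul, pow_succ]
      · rw [Finset.sum_range_succ, if_neg (by omega), mul_zero, zero_mul, add_zero, hS,
          Finset.mul_sum]
        refine Finset.sum_congr rfl fun j hj => ?_
        rw [if_pos (by have := Finset.mem_range.1 hj; omega), mul_assoc]
    rw [key]
    rcases Nat.lt_succ_iff_lt_or_eq.1 hi with hi | rfl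
    · rw [show S i = 0 from h i hi, zero_pow hq, mul_zero, sub_zero]
    · rw [← pow_succ, Nat.sub_add_cancel (Nat.pos_of_ne_zero hq), sub_self]

theorem rowLen_rowPartition (r i : ℕ) :
    (rowPartition r).rowLen i = if i = 0 then r else 0 := by
  refine eq_of_forall_lt_iff fun j => ?_
  rw [← YoungDiagram.mem_iff_lt_rowLen, rowPartition, YoungDiagram.mem_ofRowLens]
  rcases i with _ | i <;> simp

theorem colLen_rowPartition (r j : ℕ) :
    (rowPartition r).colLen j = if j < r then 1 else 0 := by
  refine eq_of_forall_lt_iff fun i => ?_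
  rw [← lt_rowLen_iff_lt_colLen, rowLen_rowPartition]
  split_ifs <;> omega

theorem completeH_zero_vars (F : Type*) [Field F] [Fintype F] (r : ℤ) (hr : r ≠ 0) : completeH F 0 r = 0 := by
  rw [completeH]
  split_ifs with h
  · rw [schur, dif_neg]
    rintro ⟨h1, -⟩
    rw [colLen_rowPartition, if_pos (by omega)] at h1
    omega
  · rfl

variable (p : ℕ) [Fact p.Prime] (F : Type*) [Field F] [Fintype F] [CharP F p] (n : ℕ)

-- A monic `q`-polynomial killing all variables, raised to the power `q^t`, expresses the vector of
-- exponent `q^(n+t)` through smaller ones.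
include p in
theorem pow_mem_span (s : ℕ) :
    (fun i : Fin n => (MvPolynomial.X i : Sym F n) ^ Fintype.card F ^ s) ∈
      Submodule.span (Sym F n) (Set.range fun (k : Fin n) (i : Fin n) =>
        (MvPolynomial.X i : Sym F n) ^ Fintype.card F ^ stair n k) := by
  induction s using Nat.strong_induction_on with
  | _ s ih =>
    rcases lt_or_ge s n with hs | hs
    · refine Submodule.subset_span ⟨⟨n - 1 - s, by omega⟩, ?_⟩
      ext1 i
      simp only [stair, show n - 1 - (n - 1 - s) = s by omega]
    · obtain ⟨t, rfl⟩ := Nat.exists_eq_add_of_le hs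
      obtain ⟨c, hc, h⟩ := exists_monic_additive p F (Sym F n)
        (fun i => if hi : i < n then MvPolynomial.X ⟨i, hi⟩ else 0) n
      obtain ⟨ψ, hψ⟩ := exists_ringHom_eq_pow p F (Sym F n) t
      have : (fun i : Fin n => (MvPolynomial.X i : Sym F n) ^ Fintype.card F ^ (n + t)) =
          -∑ j ∈ Finset.range n, ψ (c j) • fun i : Fin n =>
            (MvPolynomial.X i : Sym F n) ^ Fintype.card F ^ (j + t) := by
        ext1 i
        have := congrArg ψ (h i i.2)
        rw [Finset.sum_range_succ, hc, one_mul, map_add, map_sum, map_zero, add_comm,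
          add_eq_zero_iff_eq_neg] at this
        simp only [i.2, dif_pos, Fin.eta, map_mul, map_pow] at this
        simp only [hψ (MvPolynomial.X _), ← pow_mul, ← pow_add] at this
        rw [add_comm n t]
        simpa [Finset.sum_apply, add_comm, hψ] using this
      rw [this]
      exact Submodule.neg_mem _ (Submodule.sum_mem _ fun j hj =>
        Submodule.smul_mem _ _ (ih _ (by have := Finset.mem_range.1 hj; omega)))

include p in
theorem altDet_stair_dvd (α : Fin n → ℕ) : altDet F n (stair n) ∣ altDet F n α := by
  have h (j : Fin n) := (Submodule.mem_span_range_iff_exists_fun _).1 (pow_mem_span p F n (α j))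
  choose d hd using h
  refine ⟨(of fun k j => d j k).det, ?_⟩
  rw [altDet, altDet, ← det_mul]
  congr 1
  ext1 i j
  rw [of_apply, mul_apply, ← congrFun (hd j) i]
  simp [Finset.sum_apply, mul_comm]

-- A kernel vector would give a nonzero `q`-polynomial of degree at most `q^(n-1)` vanishing at all
-- `q^n` linear forms over `F`.
include p in
theorem altDet_stair_ne_zero : altDet F n (stair n) ≠ 0 := by
  intro h
  obtain ⟨v, hv, hMv⟩ := exists_mulVec_eq_zero_iff.2 h
  set q := Fintype.card F with hq
  have hq1 : 1 < q := Fintype.one_lt_card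
  have hinj : Function.Injective fun a : Fin n → F =>
      (∑ i, MvPolynomial.C (a i) * MvPolynomial.X i : Sym F n) := by
    intro a b hab
    ext i
    have := congrArg (MvPolynomial.coeff (Finsupp.single i 1)) hab
    simpa [MvPolynomial.coeff_sum, MvPolynomial.coeff_C_mul, MvPolynomial.coeff_X,
      Finsupp.single_left_inj] using this
  set g : Polynomial (Sym F n) := ∑ j, Polynomial.C (v j) * Polynomial.X ^ q ^ stair n j with hg
  have hg0 : g = 0 := by
    refine Polynomial.eq_zero_of_natDegree_lt_card_of_eval_eq_zero g hinj (fun a => ?_) ?_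
    · have hadd (s : ℕ) : (∑ i, MvPolynomial.C (a i) * MvPolynomial.X i : Sym F n) ^ q ^ s =
          ∑ i, MvPolynomial.C (a i) * MvPolynomial.X i ^ q ^ s := by
        obtain ⟨ψ, hψ⟩ := exists_ringHom_eq_pow p F (Sym F n) s
        rw [← hψ, map_sum]
        refine Finset.sum_congr rfl fun i _ => ?_
        rw [map_mul, hψ, hψ, ← map_pow, hq, FiniteField.pow_card_pow]
      simp only [hg, Polynomial.eval_finsetSum, Polynomial.eval_mul, Polynomial.eval_C,
        Polynomial.eval_pow, Polynomial.eval_X, hadd, Finset.mul_sum]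
      rw [Finset.sum_comm]
      refine Finset.sum_eq_zero fun i _ => ?_
      have := congrFun hMv i
      simp only [mulVec, dotProduct, of_apply, Pi.zero_apply] at this
      rw [← mul_zero (MvPolynomial.C (a i)), ← this, Finset.mul_sum]
      exact Finset.sum_congr rfl fun j _ => by ring
    · rw [Fintype.card_fun, Fintype.card_fin]
      refine lt_of_le_of_lt (Polynomial.natDegree_sum_le_of_forall_le _ _ (n := q ^ (n - 1))
        fun j _ => ?_) ?_
      · refine (Polynomial.natDegree_C_mul_X_pow_le _ _).trans (Nat.pow_le_pow_right hq1.le ?_)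
        exact Nat.sub_le _ _
      · rcases n with _ | n
        · exact absurd (Subsingleton.elim v 0) hv
        · exact Nat.pow_lt_pow_right hq1 (by omega)
  apply hv
  ext1 j
  have := congrArg (Polynomial.coeff · (q ^ stair n j)) hg0
  simp only [hg, Polynomial.finsetSum_coeff, Polynomial.coeff_C_mul, Polynomial.coeff_X_pow,
    Polynomial.coeff_zero] at this
  rw [Finset.sum_eq_single j] at this
  · simpa using this
  · intro k _ hk
    rw [if_neg, mul_zero]
    intro h
    have := Nat.pow_right_injective hq1 h
    simp only [stair] at this
    exact hk (Fin.ext (by omega))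
  · simp

include p in
theorem schur_mul_altDet (l : YoungDiagram) (hl : l.colLen 0 ≤ n) :
    altDet F n (stair n) * schur F n l = altDet F n (addStair n l) := by
  have h : l.colLen 0 ≤ n ∧ altDet F n (stair n) ∣ altDet F n (addStair n l) :=
    ⟨hl, altDet_stair_dvd p F n _⟩
  rw [schur, dif_pos h]
  exact h.2.choose_spec.symm

theorem completeH_of_neg (r : ℤ) (hr : r < 0) : completeH F n r = 0 := by
  rw [completeH, if_neg (by omega)]

theorem elemE_of_neg (r : ℤ) (hr : r < 0) : elemE F n r = 0 := by
  rw [elemE, if_neg (by omega)]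

theorem elemE_of_gt (r : ℤ) (hr : (n : ℤ) < r) : elemE F n r = 0 := by
  rw [elemE, if_neg (by omega)]

include p in
theorem schur_eq_one (l : YoungDiagram) (hl : l.colLen 0 = 0) : schur F n l = 1 := by
  refine mul_left_cancel₀ (altDet_stair_ne_zero p F n) ?_
  rw [schur_mul_altDet p F n l (by omega), mul_one]
  congr 1
  ext j
  simp [addStair, rowLen_eq_zero (l := l) (i := j) (by omega)]

include p in
theorem completeH_zero : completeH F n 0 = 1 := by
  rw [completeH, if_pos le_rfl]
  exact schur_eq_one p F n _ (by simp [colLen_rowPartition])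

include p in
theorem elemE_zero : elemE F n 0 = 1 := by
  rw [elemE, if_pos ⟨le_rfl, by omega⟩]
  refine schur_eq_one p F n _ ?_
  rw [colPartition, YoungDiagram.colLen_transpose]
  simp [rowLen_rowPartition]

include p in
theorem altDet_mul_elemE (r : ℕ) (hr : r ≤ n) :
    altDet F n (stair n) * elemE F n r =
      altDet F n fun j => (if (j : ℕ) < r then 1 else 0) + stair n j := by
  rw [elemE, if_pos (by omega), Int.toNat_natCast, schur_mul_altDet p F n]
  · congr 1
    ext j
    rw [addStair, colPartition, YoungDiagram.rowLen_transpose, colLen_rowPartition]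
  · rw [colPartition, YoungDiagram.colLen_transpose, rowLen_rowPartition]
    simpa using hr

include p in
/-- The `x_i` are zeros of the `q`-polynomial with coefficients `(-1)^r E_r`. -/
theorem sum_elemE_mul_pow (i : Fin n) : ∑ r ∈ Finset.range (n + 1),
    (-1) ^ r * elemE F n r * (MvPolynomial.X i : Sym F n) ^ Fintype.card F ^ (n - r) = 0 := by
  refine mul_left_cancel₀ (altDet_stair_ne_zero p F n) ?_
  -- Row `0` repeats the row of `x_i`. Deleting it and column `r` leaves the alternant of `(1^r) +
  -- δ`.
  set M : Matrix (Fin (n + 1)) (Fin (n + 1)) (Sym F n) := of fun k j =>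
    (Fin.cons (MvPolynomial.X i) MvPolynomial.X : Fin (n + 1) → Sym F n) k ^
      Fintype.card F ^ (n - (j : ℕ)) with hM
  have hdet : M.det = 0 := by
    refine det_zero_of_row_eq (i := 0) (j := i.succ) (Fin.succ_ne_zero i).symm ?_
    ext1 j
    simp [hM]
  rw [mul_zero, ← hdet, det_succ_row_zero, Finset.mul_sum, Finset.sum_range]
  refine Finset.sum_congr rfl fun r _ => ?_
  rw [show (M.submatrix Fin.succ r.succAbove).det = altDet F n (stair n) * elemE F n (r : ℕ) by
    rw [altDet_mul_elemE p F n _ (by omega), altDet]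
    congr 1
    ext1 k j
    simp only [hM, submatrix_apply, of_apply, Fin.cons_succ]
    congr 2
    simp only [stair, Fin.succAbove, Fin.lt_def, Fin.val_castSucc]
    split_ifs
    · simp only [Fin.val_castSucc]; omega
    · simp only [Fin.val_succ]; omega]
  simp only [hM, of_apply, Fin.cons_zero]
  ring

-- This form suits Cramer's rule. For `s < n` the new column repeats an old one, which matches `H`
-- vanishing at negative index.
include p in
theorem altDet_mul_completeH (s : ℕ) :
    altDet F (n + 1) (stair (n + 1)) * completeH F (n + 1) ((s : ℤ) - n) =
      ((of fun i j : Fin (n + 1) =>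
        (MvPolynomial.X i : Sym F (n + 1)) ^ Fintype.card F ^ stair (n + 1) j).updateCol 0
        fun i => MvPolynomial.X i ^ Fintype.card F ^ s).det := by
  rcases lt_or_ge s n with hs | hs
  · rw [completeH_of_neg _ _ _ (by omega), mul_zero]
    symm
    refine det_zero_of_column_eq (i := 0) (j := ⟨n - s, by omega⟩) ?_ fun k => ?_
    · intro h
      have := congrArg Fin.val h
      simp only [Fin.val_zero] at this
      omega
    · rw [updateCol_self, updateCol_ne]
      · simp only [of_apply, stair]
        congr 2
        omega
      · intro h
        have := congrArg Fin.val h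
        simp only [Fin.val_zero] at this
        omega
  · rw [completeH, if_pos (by omega), schur_mul_altDet p]
    · rw [altDet]
      congr 1
      ext1 i j
      rw [of_apply, updateCol_apply, of_apply, addStair, rowLen_rowPartition]
      split_ifs with h1 h2 h2
      · simp only [h2, stair, Fin.val_zero]
        congr 2
        omega
      · exact absurd (Fin.ext h1) h2
      · exact absurd (congrArg Fin.val h2) h1
      · simp
    · rw [colLen_rowPartition]
      split_ifs <;> omega

include p in
theorem sum_elemE_mul_completeH (s : ℕ) : ∑ r ∈ Finset.range (s + 2),
    (-1) ^ r * elemE F n r ^ Fintype.card F ^ s * completeH F n ((s : ℤ) + 1 - r) = 0 := by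
  have hq (s : ℕ) : Fintype.card F ^ s ≠ 0 := pow_ne_zero _ Fintype.card_ne_zero
  -- Both ranges extend by zeros to a common one: `H` vanishes past `s + 1` and `E` past `n`.
  have hrange : ∑ r ∈ Finset.range (s + 2),
      (-1) ^ r * elemE F n r ^ Fintype.card F ^ s * completeH F n ((s : ℤ) + 1 - r) =
      ∑ r ∈ Finset.range (n + 1),
      (-1) ^ r * elemE F n r ^ Fintype.card F ^ s * completeH F n ((s : ℤ) + 1 - r) := by
    have h1 := Finset.sum_subset (f := fun r : ℕ =>
        (-1) ^ r * elemE F n r ^ Fintype.card F ^ s * completeH F n ((s : ℤ) + 1 - r))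
      (Finset.range_mono (show s + 2 ≤ s + 2 + (n + 1) by omega))
      (fun r _ hr => by
        rw [completeH_of_neg _ _ _ (by simp only [Finset.mem_range] at hr; omega), mul_zero])
    have h2 := Finset.sum_subset (f := fun r : ℕ =>
        (-1) ^ r * elemE F n r ^ Fintype.card F ^ s * completeH F n ((s : ℤ) + 1 - r))
      (Finset.range_mono (show n + 1 ≤ s + 2 + (n + 1) by omega))
      (fun r _ hr => by
        rw [elemE_of_gt _ _ _ (by simp only [Finset.mem_range] at hr; omega), zero_pow (hq s)]
        simp)
    rw [h1, h2]
  rw [hrange]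
  -- Without variables there is no column `0` to replace, so this case is separate.
  rcases n with _ | n
  · simp [completeH_zero_vars F ((s : ℤ) + 1) (by omega)]
  refine mul_left_cancel₀ (altDet_stair_ne_zero p F (n + 1)) ?_
  obtain ⟨ψ, hψ⟩ := exists_ringHom_eq_pow p F (Sym F (n + 1)) s
  rw [mul_zero, Finset.mul_sum]
  set M : Matrix (Fin (n + 1)) (Fin (n + 1)) (Sym F (n + 1)) :=
    of fun i j => MvPolynomial.X i ^ Fintype.card F ^ stair (n + 1) j with hM
  have hterm (r : ℕ) (hr : r ∈ Finset.range (n + 1 + 1)) :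
      altDet F (n + 1) (stair (n + 1)) * ((-1) ^ r *
        elemE F (n + 1) r ^ Fintype.card F ^ s * completeH F (n + 1) ((s : ℤ) + 1 - r)) =
      cramer M (((-1) ^ r * elemE F (n + 1) r ^ Fintype.card F ^ s) •
        fun i => MvPolynomial.X i ^ Fintype.card F ^ (n + 1 - r + s)) 0 := by
    have := Finset.mem_range.1 hr
    rw [map_smul, Pi.smul_apply, cramer_apply, ← altDet_mul_completeH p,
      show ((n + 1 - r + s : ℕ) : ℤ) - n = (s : ℤ) + 1 - r by omega, smul_eq_mul]
    ring
  rw [Finset.sum_congr rfl hterm, ← Finset.sum_apply, ← map_sum]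
  refine Eq.trans (congrFun (congrArg (cramer M) ?_) 0) (congrFun (map_zero (cramer M)) 0)
  ext1 i
  have := congrArg ψ (sum_elemE_mul_pow p F (n + 1) i)
  rw [map_zero, map_sum] at this
  rw [Finset.sum_apply, Pi.zero_apply, ← this]
  refine Finset.sum_congr rfl fun r _ => ?_
  rw [map_mul, map_mul, map_pow, map_neg, map_one, hψ, hψ, Pi.smul_apply, smul_eq_mul, ← pow_mul,
    ← pow_add]

end Moore

/-! ### Transfer to the perfection -/

section Perfection

variable (p : ℕ) [Fact p.Prime] (F : Type*) [Field F] [Fintype F] [CharP F p] (n : ℕ)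

theorem frob_zpow_natCast_of (s : ℕ) (a : Sym F n) :
    (frob p F n ^ (s : ℤ)) (PerfectClosure.of (Sym F n) p a) =
      PerfectClosure.of (Sym F n) p (a ^ Fintype.card F ^ s) := by
  rw [zpow_natCast]
  induction s generalizing a with
  | zero => simp
  | succ s ih =>
    rw [pow_succ, RingAut.mul_apply, frob_apply, ← map_pow, ih, ← pow_mul, ← pow_succ']

-- Allows cancelling `A_δ` in the perfection.
omit [Fintype F] in
theorem mul_of_eq_zero {a : PerfSym p F n} {d : Sym F n} (hd : d ≠ 0)
    (h : a * PerfectClosure.of (Sym F n) p d = 0) : a = 0 := by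
  induction a using PerfectClosure.induction_on with
  | _ x =>
    rw [PerfectClosure.of_apply, PerfectClosure.mk_mul_mk, PerfectClosure.zero_def,
      PerfectClosure.eq_iff] at h
    simp only [Function.iterate_zero, id_eq, ← coe_iterateFrobenius, map_zero, add_zero,
      mul_eq_zero] at h
    rcases h with h | h
    · have : x = (x.1, 0) := Prod.ext rfl h
      rw [this, PerfectClosure.mk_zero_right]
    · rw [iterateFrobenius_def] at h
      exact absurd (pow_eq_zero_iff (pow_ne_zero _ (Fact.out : p.Prime).ne_zero) |>.1 h) hd

theorem sum_frob_elemE_mul_completeH (s : ℕ) : ∑ r ∈ Finset.range (s + 2),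
    (-1) ^ r * (frob p F n ^ (s : ℤ)) (PerfectClosure.of (Sym F n) p (elemE F n r)) *
      PerfectClosure.of (Sym F n) p (completeH F n ((s : ℤ) + 1 - r)) = 0 := by
  rw [← map_zero (PerfectClosure.of (Sym F n) p), ← sum_elemE_mul_completeH p F n s, map_sum]
  refine Finset.sum_congr rfl fun r _ => ?_
  rw [frob_zpow_natCast_of, map_mul, map_mul, map_pow _ (-1), map_neg, map_one]

/-- The Jacobi–Trudi formula. -/
theorem of_schur_eq_det_matH (l : YoungDiagram) (hl : l.colLen 0 ≤ n) :
    PerfectClosure.of (Sym F n) p (schur F n l) = (matH p F n n l ⊥).det := by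
  set ι := PerfectClosure.of (Sym F n) p with hι
  obtain ⟨y, hy⟩ := det_zpow_eq_mul (frob p F n) (E := fun r => ι (elemE F n r))
    (H := fun r => ι (completeH F n r)) (fun i : Fin n => ι (MvPolynomial.X i))
    (fun r hr => by rw [elemE_of_neg _ _ _ hr, map_zero]) (by rw [elemE_zero p, map_one])
    (fun r hr => by rw [elemE_of_gt _ _ _ hr, map_zero])
    (fun r hr => by rw [completeH_of_neg _ _ _ hr, map_zero])
    (by rw [completeH_zero p, map_one]) (sum_frob_elemE_mul_completeH p F n)
    (fun i => by
      rw [← map_zero ι, ← sum_elemE_mul_pow p F n i, map_sum]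
      refine Finset.sum_congr rfl fun r hr => ?_
      have := Finset.mem_range.1 hr
      rw [show (n : ℤ) - r = ((n - r : ℕ) : ℤ) by omega, frob_zpow_natCast_of, map_mul, map_mul,
        map_pow _ (-1), map_neg, map_one]) (l.rowLen 0)
  have hA (l' : YoungDiagram) (h₁ : l'.colLen 0 ≤ n) (h₂ : l'.rowLen 0 ≤ l.rowLen 0) :
      ι (altDet F n (addStair n l')) = (matH p F n n l' ⊥).det * y := by
    rw [show matH p F n n l' ⊥ = skewH (frob p F n) (fun r => ι (completeH F n r)) n l' ⊥ from rfl,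
      ← hy l' h₁ h₂, altDet, RingHom.map_det, ← det_transpose]
    congr 1
    ext1 i k
    simp only [transpose_apply, RingHom.mapMatrix_apply, map_apply, of_apply]
    rw [show (l'.rowLen i : ℤ) + (n - 1 - (i : ℕ)) = (addStair n l' i : ℕ) by
      simp only [addStair, stair]; omega, frob_zpow_natCast_of]
  have hbot := bot_colLen_rowLen
  have hone : (matH p F n n ⊥ ⊥).det = 1 := by
    rw [show matH p F n n ⊥ ⊥ = skewH (frob p F n) (fun r => ι (completeH F n r)) n ⊥ ⊥ from rfl,
      det_skewH_eq (frob p F n) (fun r hr => by rw [completeH_of_neg _ _ _ hr, map_zero])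
      (by rw [completeH_zero p, map_one]) ⊥ ⊥ 0 n hbot.1.le hbot.1.le (Nat.zero_le _),
      det_fin_zero]
  -- The empty partition has `H`-determinant `1`, which pins down the common factor.
  have hy' : ι (altDet F n (stair n)) = y := by
    rw [← one_mul y, ← hone, ← hA ⊥ (by omega) (by omega)]
    congr 2
    ext j
    simp [addStair, rowLen_eq_zero (l := ⊥) (i := j) (by omega)]
  refine sub_eq_zero.1 (mul_of_eq_zero p F n (altDet_stair_ne_zero p F n) ?_)
  rw [sub_mul, ← map_mul, mul_comm (schur F n l), schur_mul_altDet p F n l hl, ← hι, hy',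
    hA l hl le_rfl, sub_self]

end Perfection

end FrobeniusSchur

/-! ### The three claims -/

theorem mainTheorem8 (p : ℕ) [Fact p.Prime] (F : Type*) [Field F] [Fintype F] [CharP F p]
    (n : ℕ) :
    (∀ l mu : YoungDiagram,
      (∀ m : ℕ, l.colLen 0 ≤ m → mu.colLen 0 ≤ m →
        FrobeniusSchur.skewSchur p F n l mu =
          (FrobeniusSchur.matH p F n m l mu).det) ∧
      (∀ m : ℕ, l.rowLen 0 ≤ m → mu.rowLen 0 ≤ m →
        FrobeniusSchur.skewSchur p F n l mu =
          (FrobeniusSchur.matE p F n m l mu).det)) ∧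
    (∀ l : YoungDiagram, l.colLen 0 ≤ n → ∀ m : ℕ, l.rowLen 0 ≤ m →
      PerfectClosure.of (FrobeniusSchur.Sym F n) p (FrobeniusSchur.schur F n l) =
        Matrix.det (Matrix.of fun i j : Fin m =>
          (FrobeniusSchur.frob p F n ^ (j : ℕ))
            (PerfectClosure.of (FrobeniusSchur.Sym F n) p
              (FrobeniusSchur.elemE F n ((l.colLen i : ℤ) - (i : ℕ) + (j : ℕ)))))) := by
  open FrobeniusSchur in
  set ι := PerfectClosure.of (FrobeniusSchur.Sym F n) p
  have hE (r : ℤ) (hr : r < 0) : ι (elemE F n r) = 0 := by rw [elemE_of_neg _ _ _ hr, map_zero]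
  have hE0 : ι (elemE F n 0) = 1 := by rw [elemE_zero p, map_one]
  have hH (r : ℤ) (hr : r < 0) : ι (completeH F n r) = 0 := by
    rw [completeH_of_neg _ _ _ hr, map_zero]
  have hH0 : ι (completeH F n 0) = 1 := by rw [completeH_zero p, map_one]
  have claim₁ (l mu : YoungDiagram) (m : ℕ) (h₁ : l.colLen 0 ≤ m) (h₂ : mu.colLen 0 ≤ m) :
      skewSchur p F n l mu = (matH p F n m l mu).det :=
    (det_skewH_eq (frob p F n) (H := fun r => ι (completeH F n r)) hH hH0 l mu _ m
      (le_max_left _ _) (le_max_right _ _) (max_le h₁ h₂)).symm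
  have claim₂ (l mu : YoungDiagram) (m : ℕ) (h₁ : l.rowLen 0 ≤ m) (h₂ : mu.rowLen 0 ≤ m) :
      skewSchur p F n l mu = (matE p F n m l mu).det :=
    det_skewH_eq_det_skewE (frob p F n) (E := fun r => ι (elemE F n r))
      (H := fun r => ι (completeH F n r)) hE hE0 hH hH0 (sum_frob_elemE_mul_completeH p F n) l mu
      (le_max_left _ _) h₁ (le_max_right _ _) h₂
  refine ⟨fun l mu => ⟨claim₁ l mu, claim₂ l mu⟩, fun l hl m hm => ?_⟩
  have hbot := bot_colLen_rowLen
  -- Size independence passes from the `n × n` determinant to the skew function with `μ = ∅`, where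
  -- duality applies.
  rw [of_schur_eq_det_matH p F n l hl, ← claim₁ l ⊥ n hl (by omega), claim₂ l ⊥ m hm (by omega)]
  congr 1
  ext1 i j
  have h0 : (⊥ : YoungDiagram).colLen j = 0 := by
    have := (⊥ : YoungDiagram).colLen_anti 0 j (Nat.zero_le _)
    omega
  simp only [matE, Matrix.of_apply, h0, Nat.cast_zero, neg_zero, zero_add, sub_zero, zpow_natCast]
  rfl
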